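/- Let $p$ be an odd prime, and let $G_1$ and $G_2$ be nontrivial groups (finite or infinite) of exponent $p$ that are nilpotent of class at most two. Let $F = G_1 * G_2$ be their free product, with lower central series $F_1 = F$, $F_{n+1} = [F_n, F]$, and let $G = G_1 \amalg^{\mathfrak{N}_2} G_2 = F/F_3$ be the 2-nilpotent product of $G_1$ and $G_2$, that is, their coproduct in the variety $\mathfrak{N}_2$ of nilpotent groups of class at most two. Then $G$ is capable: there is a group $H$ such that $G \cong H/Z(H)$, where $Z(H)$ is the center of $H$. -/

import Mathlib

universe u v

/-- A group `G` is capable if it is isomorphic to `H / Z(H)` for some group `H`. -/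
def IsCapable (G : Type u) [Group G] : Prop :=
  ∃ (H : Type u) (_ : Group H), Nonempty (G ≃* H ⧸ Subgroup.center H)

/-- `G` is nilpotent of class at most `k`: the `(k+1)`-st term of the lower central series
is trivial. (Mathlib numbers the terms from `0`, so this is the term with index `k`.) -/
def IsNilpotentOfClassLE (k : ℕ) (G : Type u) [Group G] : Prop :=
  (⊤ : Subgroup G).lowerCentralSeries k = ⊥

/-- The `k`-nilpotent product of two groups: the quotient of their free product `F` by the
`(k+1)`-st term `F_{k+1}` of its lower central series (`F_1 = F`). For factors of class at
most `k` it is their coproduct in the variety of nilpotent groups of class at most `k`. -/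
abbrev NilpotentProduct (k : ℕ) (A : Type u) (B : Type v) [Group A] [Group B] : Type (max u v) :=
  Monoid.Coprod A B ⧸ (⊤ : Subgroup (Monoid.Coprod A B)).lowerCentralSeries k

open scoped commutatorElement IsMulCommutative TensorProduct

/-! Take `H = F/F_4`. Since `F_3/F_4` is central in `H`, it suffices that every `x` in `F` that is
central modulo `F_4` lies in `F_3`; then `H/Z(H) = F/F_3`. (`F_{n+1}` is `lowerCentralSeries n`.)

Such `x` are detected by actions of `F` on pairs (function `G → R`, scalar): the factor `G`
translates functions, and `b` in the factor `K` adds `θ(b) q` times the scalar to the function. If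
`q` is polynomial of degree at most two, the action is unipotent along a chain of length four, so
`F_4` fixes `(0, 1)` and `x` commutes with `F` on this vector (`coprodAction_comm`).

Two choices of `q` suffice. By Baer's trick, `G` carries an elementary abelian `p`-group structure
whose linear functionals are quadratic on `G` and separate points; commuting with the second factor
then forces the projection of `x` to `G` to be trivial (`fst_eq_one_of_central`), and by symmetry
the one to `K`. So modulo `F_3`, `x` is a product of mixed commutators, the image of a tensor `t` in
`G^ab ⊗ K^ab`. With `q = f ^ 2`, `f` linear on `G^ab`, commuting with the first factor makes every
`f ⊗ g` vanish on `t`, so `t = 0` (`mk_eq_one_of_mem_mixedCommutators`). -/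

theorem endMul_apply {X : Type*} [AddCommGroup X] (f g : AddMonoid.End X) (x : X) :
    (f * g) x = f (g x) := rfl

theorem endOne_apply {X : Type*} [AddCommGroup X] (x : X) : (1 : AddMonoid.End X) x = x := rfl

/-- If a group acts on `X` so that `g - 1` maps `Z (k + 1)` into `Z k` for every `g`, then for `g`
in the `n`-th term of the lower central series `g - 1` maps `Z (k + n + 1)` into `Z k`. -/
theorem sub_mem_of_mem_lowerCentralSeries {Γ X : Type*} [Group Γ] [AddCommGroup X]
    (ρ : Γ →* AddMonoid.End X) (Z : ℕ → AddSubgroup X) (hZ : Monotone Z)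
    (hρ : ∀ g k, ∀ x ∈ Z (k + 1), ρ g x - x ∈ Z k) (n : ℕ) :
    ∀ g ∈ (⊤ : Subgroup Γ).lowerCentralSeries n, ∀ k, ∀ x ∈ Z (k + n + 1), ρ g x - x ∈ Z k := by
  have hmem : ∀ g k, ∀ x ∈ Z (k + 1), ρ g x ∈ Z (k + 1) := fun g k x hx ↦ by
    have h := add_mem (hZ (Nat.le_succ k) (hρ g k x hx)) hx
    rwa [sub_add_cancel] at h
  induction n with
  | zero => exact fun g _ k x hx ↦ hρ g k x hx
  | succ n ih =>
    intro g hg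
    rw [Subgroup.mem_lowerCentralSeries_succ_iff] at hg
    induction hg using Subgroup.closure_induction with
    | one => intro k x _; simp
    | mul a b _ _ ha hb =>
      intro k x hx
      have e : ρ (a * b) x - x = (ρ a (ρ b x) - ρ b x) + (ρ b x - x) := by
        rw [map_mul, endMul_apply]; abel
      rw [e]
      exact add_mem (ha k _ (hmem b _ x hx)) (hb k x hx)
    | inv a _ ha =>
      intro k x hx
      have h := neg_mem (ha k _ (hmem a⁻¹ _ x hx))
      rwa [← endMul_apply, ← map_mul, mul_inv_cancel, map_one, endOne_apply,
        neg_sub] at h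
    | mem c hc =>
      obtain ⟨a, ha, b, -, rfl⟩ := hc
      intro k x hx
      have hy := hmem a⁻¹ _ _ (hmem b⁻¹ _ x hx)
      rw [← endMul_apply, ← map_mul, ← mul_inv_rev] at hy
      -- Since `⁅a, b⁆ * (b * a) = a * b`, evaluating at `ρ (b * a) y` removes all inverses: the
      -- difference becomes the commutator of `a - 1` and `b - 1` applied to `y`.
      obtain ⟨y, rfl⟩ : ∃ y, x = ρ (b * a) y := ⟨ρ (b * a)⁻¹ x, by
        rw [← endMul_apply, ← map_mul, mul_inv_cancel, map_one,
          endOne_apply]⟩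
      rw [← endMul_apply, ← map_mul, inv_mul_cancel, map_one,
        endOne_apply, show k + (n + 1) + 1 = (k + n + 1) + 1 by ring] at hy
      have e : ρ ⁅a, b⁆ (ρ (b * a) y) - ρ (b * a) y =
          (ρ a (ρ b y - y) - (ρ b y - y)) - (ρ b (ρ a y - y) - (ρ a y - y)) := by
        have : ⁅a, b⁆ * (b * a) = a * b := by rw [commutatorElement_def]; group
        rw [← endMul_apply, ← map_mul, this]
        simp only [map_mul, endMul_apply, map_sub]
        abel
      rw [e]
      refine sub_mem (ih a ha k _ (hρ b _ y hy)) (hρ b k _ (ih a ha (k + 1) y ?_))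
      convert hy using 2
      ring

/-! ### Polynomial functions on a group. -/

section PolynomialFunctions

variable (G : Type*) [Group G] (R : Type*) [AddCommGroup R]

/-- The action of `G` on the functions on `G` by right translation. -/
def rightTranslation : G →* AddMonoid.End (G → R) where
  toFun a := { toFun := fun f y ↦ f (y * a), map_zero' := rfl, map_add' := fun _ _ ↦ rfl }
  map_one' := AddMonoidHom.ext fun f ↦ funext fun y ↦ congrArg f (mul_one y)
  map_mul' a b := AddMonoidHom.ext fun f ↦ funext fun y ↦ congrArg f (mul_assoc y a b).symm

variable {G R} in
@[simp]
theorem rightTranslation_apply (a : G) (f : G → R) (y : G) :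
    rightTranslation G R a f y = f (y * a) := rfl

/-- The functions on `G` that are polynomial of degree less than `k`: those killed by all
`k`-fold differences. -/
def polynomialLT : ℕ → AddSubgroup (G → R)
  | 0 => ⊥
  | k + 1 => ⨅ a : G, (polynomialLT k).comap (rightTranslation G R a - 1 : AddMonoid.End (G → R))

variable {G R}

theorem mem_polynomialLT_zero {f : G → R} : f ∈ polynomialLT G R 0 ↔ f = 0 := Iff.rfl

theorem mem_polynomialLT_succ {f : G → R} {k : ℕ} :
    f ∈ polynomialLT G R (k + 1) ↔ ∀ a, rightTranslation G R a f - f ∈ polynomialLT G R k := by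
  simp only [polynomialLT, AddSubgroup.mem_iInf]
  rfl

theorem polynomialLT_mono : Monotone (polynomialLT G R) := by
  refine monotone_nat_of_le_succ fun k ↦ ?_
  induction k with
  | zero => exact bot_le
  | succ k ih =>
    intro f hf
    rw [mem_polynomialLT_succ] at hf ⊢
    exact fun a ↦ ih (hf a)

theorem const_mem_polynomialLT_one (f : G → R) (c : R) (hf : ∀ y, f y = c) :
    f ∈ polynomialLT G R 1 := by
  rw [mem_polynomialLT_succ]
  intro a
  rw [mem_polynomialLT_zero]
  ext y
  simp [hf]

/-- A function with bi-additive second difference is polynomial of degree at most two. -/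
theorem mem_polynomialLT_three {q : G → R} {b : G → G → R}
    (hq : ∀ x y, q (x * y) = q x + q y + b x y)
    (hb : ∀ x y z, b (x * y) z = b x z + b y z) : q ∈ polynomialLT G R 3 := by
  simp_rw [mem_polynomialLT_succ (k := 2), mem_polynomialLT_succ (k := 1)]
  intro a c
  refine const_mem_polynomialLT_one _ (b c a) fun y ↦ ?_
  simp only [Pi.sub_apply, rightTranslation_apply, hq, hb]
  abel

end PolynomialFunctions

/-! ### The unipotent action of the free product. -/

section Action

variable {G : Type u} {K : Type v} [Group G] [Group K] {R : Type*} [CommRing R]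

/-- `G` acts on functions by translation and trivially on scalars. -/
def translationAction (G : Type u) [Group G] (R : Type*) [CommRing R] :
    G →* AddMonoid.End ((G → R) × R) where
  toFun a := AddMonoidHom.prodMap (rightTranslation G R a) (AddMonoidHom.id R)
  map_one' := by rw [map_one]; rfl
  map_mul' a b := by rw [map_mul]; rfl

/-- `K` acts by transvections along `q` through the character `θ`. -/
def transvectionAction (q : G → R) (θ : Additive K →+ R) :
    K →* AddMonoid.End ((G → R) × R) where
  toFun b :=
    { toFun := fun x ↦ (x.1 + (x.2 * θ (.ofMul b)) • q, x.2)
      map_zero' := by simp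
      map_add' := fun x y ↦ by ext <;> simp; ring }
  map_one' := AddMonoidHom.ext fun x ↦ Prod.ext
    (show x.1 + (x.2 * θ (.ofMul 1)) • q = x.1 by simp) rfl
  map_mul' a b := AddMonoidHom.ext fun x ↦ Prod.ext
    (show x.1 + (x.2 * θ (.ofMul (a * b))) • q =
        x.1 + (x.2 * θ (.ofMul b)) • q + (x.2 * θ (.ofMul a)) • q by
      rw [ofMul_mul, map_add]; module)
    rfl

/-- The free product of `G` and `K` acting on pairs of a function on `G` and a scalar. -/
def coprodAction (q : G → R) (θ : Additive K →+ R) :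
    Monoid.Coprod G K →* AddMonoid.End ((G → R) × R) :=
  Monoid.Coprod.lift (translationAction G R) (transvectionAction q θ)

variable (q : G → R) (θ : Additive K →+ R)

@[simp]
theorem coprodAction_inl (a : G) (x : (G → R) × R) :
    coprodAction q θ (.inl a) x = (rightTranslation G R a x.1, x.2) := by
  simp only [coprodAction, Monoid.Coprod.lift_apply_inl]; rfl

@[simp]
theorem coprodAction_inr (b : K) (x : (G → R) × R) :
    coprodAction q θ (.inr b) x = (x.1 + (x.2 * θ (.ofMul b)) • q, x.2) := by
  simp only [coprodAction, Monoid.Coprod.lift_apply_inr]; rfl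

theorem coprodAction_snd (g : Monoid.Coprod G K) (x : (G → R) × R) :
    (coprodAction q θ g x).2 = x.2 := by
  induction g using Monoid.Coprod.induction_on generalizing x with
  | inl a => simp
  | inr b => simp
  | mul g h hg hh => rw [map_mul, endMul_apply, hg, hh]

theorem coprodAction_zero_right (g : Monoid.Coprod G K) (f : G → R) :
    coprodAction q θ g (f, 0) = (rightTranslation G R (Monoid.Coprod.fst g) f, 0) := by
  induction g using Monoid.Coprod.induction_on generalizing f with
  | inl a => simp
  | inr b => simp
  | mul g h hg hh =>
    rw [map_mul, endMul_apply, hh, hg, map_mul, map_mul, endMul_apply]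

/-- The chain of subgroups witnessing that the action is unipotent. -/
def actionChain (G : Type u) [Group G] (R : Type*) [CommRing R] (k : ℕ) :
    AddSubgroup ((G → R) × R) where
  -- A nonzero scalar is allowed only from level 4 on: a transvection then produces multiples of
  -- `q`, which lie at level 3.
  carrier := {x | x.1 ∈ polynomialLT G R k ∧ (k ≤ 3 → x.2 = 0)}
  zero_mem' := ⟨zero_mem _, fun _ ↦ rfl⟩
  add_mem' hx hy := ⟨add_mem hx.1 hy.1, fun h ↦ by simp [hx.2 h, hy.2 h]⟩
  neg_mem' hx := ⟨neg_mem hx.1, fun h ↦ by simp [hx.2 h]⟩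

theorem mem_actionChain {k : ℕ} {x : (G → R) × R} :
    x ∈ actionChain G R k ↔ x.1 ∈ polynomialLT G R k ∧ (k ≤ 3 → x.2 = 0) := Iff.rfl

theorem actionChain_mono : Monotone (actionChain G R) := fun _ _ h _ hx ↦
  ⟨polynomialLT_mono h hx.1, fun h' ↦ hx.2 (h.trans h')⟩

theorem smul_mem_polynomialLT {k : ℕ} {f : G → R} (c : R) (hf : f ∈ polynomialLT G R k) :
    c • f ∈ polynomialLT G R k := by
  induction k generalizing f with
  | zero => rw [mem_polynomialLT_zero] at hf ⊢; rw [hf, smul_zero]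
  | succ k ih =>
    rw [mem_polynomialLT_succ] at hf ⊢
    intro a
    have e : rightTranslation G R a (c • f) - c • f = c • (rightTranslation G R a f - f) := by
      ext y; simp [mul_sub]
    rw [e]
    exact ih (hf a)

variable {q}

theorem coprodAction_sub_mem (hq : q ∈ polynomialLT G R 3) (g : Monoid.Coprod G K) (k : ℕ)
    (x : (G → R) × R) (hx : x ∈ actionChain G R (k + 1)) :
    coprodAction q θ g x - x ∈ actionChain G R k := by
  induction g using Monoid.Coprod.induction_on generalizing x with
  | inl a =>
    rw [coprodAction_inl, mem_actionChain]
    exact ⟨mem_polynomialLT_succ.1 hx.1 a, fun _ ↦ by simp⟩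
  | inr b =>
    rw [coprodAction_inr, mem_actionChain]
    refine ⟨?_, fun _ ↦ by simp⟩
    simp only [Prod.fst_sub, add_sub_cancel_left]
    by_cases hk : k + 1 ≤ 3
    · simp [hx.2 hk]
    · exact polynomialLT_mono (by omega) (smul_mem_polynomialLT _ hq)
  | mul g h hg hh =>
    have e : coprodAction q θ (g * h) x - x =
        (coprodAction q θ g (coprodAction q θ h x) - coprodAction q θ h x) +
          (coprodAction q θ h x - x) := by
      rw [map_mul, endMul_apply]; abel
    rw [e]
    refine add_mem (hg _ ?_) (hh x hx)
    have h := add_mem (actionChain_mono (Nat.le_succ k) (hh x hx)) hx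
    rwa [sub_add_cancel] at h

theorem zero_one_mem_actionChain : ((0, 1) : (G → R) × R) ∈ actionChain G R 4 :=
  ⟨zero_mem _, fun h ↦ by omega⟩

/-- The fourth term of the lower central series fixes `(0, 1)`, and hence its whole orbit. -/
theorem coprodAction_zero_one_of_mem_lowerCentralSeries_three (hq : q ∈ polynomialLT G R 3)
    {g : Monoid.Coprod G K} (hg : g ∈ (⊤ : Subgroup (Monoid.Coprod G K)).lowerCentralSeries 3) :
    coprodAction q θ g (0, 1) = (0, 1) := by
  have h := sub_mem_of_mem_lowerCentralSeries (coprodAction q θ) (actionChain G R)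
    actionChain_mono (coprodAction_sub_mem θ hq) 3 g hg 0 (0, 1) zero_one_mem_actionChain
  obtain ⟨h1, h2⟩ := h
  rw [mem_polynomialLT_zero] at h1
  exact sub_eq_zero.1 (Prod.ext h1 (h2 (by omega)))

/-- The third term lowers the level from 4 to 1, and level 1 consists of constant functions with
scalar 0. -/
theorem coprodAction_zero_one_of_mem_lowerCentralSeries_two (hq : q ∈ polynomialLT G R 3)
    {g : Monoid.Coprod G K} (hg : g ∈ (⊤ : Subgroup (Monoid.Coprod G K)).lowerCentralSeries 2) :
    ∃ c : R, coprodAction q θ g (0, 1) = (fun _ ↦ c, 1) := by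
  obtain ⟨h1, h2⟩ := sub_mem_of_mem_lowerCentralSeries (coprodAction q θ) (actionChain G R)
    actionChain_mono (coprodAction_sub_mem θ hq) 2 g hg 1 (0, 1) zero_one_mem_actionChain
  rw [mem_polynomialLT_succ] at h1
  refine ⟨(coprodAction q θ g (0, 1)).1 1, Prod.ext (funext fun y ↦ ?_) (coprodAction_snd ..)⟩
  have h3 := congrFun (mem_polynomialLT_zero.1 (h1 y)) 1
  simpa [sub_eq_zero] using h3

end Action

/-! ### Groups of class two and Baer's sum. -/

section ClassTwo

variable {G : Type u} [Group G]

theorem IsNilpotentOfClassLE.commutatorElement_mem_center (hc : IsNilpotentOfClassLE 2 G)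
    (a b : G) : ⁅a, b⁆ ∈ Subgroup.center G := by
  rw [Subgroup.mem_center_iff]
  intro c
  have h : ⁅⁅a, b⁆, c⁆ ∈ (⊤ : Subgroup G).lowerCentralSeries 2 :=
    Subgroup.commutator_mem_commutator
      (Subgroup.commutator_mem_commutator (Subgroup.mem_top a) (Subgroup.mem_top b))
      (Subgroup.mem_top c)
  rw [show (⊤ : Subgroup G).lowerCentralSeries 2 = ⊥ from hc, Subgroup.mem_bot,
    commutatorElement_eq_one_iff_mul_comm] at h
  exact h.symm

/-- The commutator of a group of class at most two, as a bimultiplicative map. -/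
def commutatorPairing (hc : IsNilpotentOfClassLE 2 G) : G →* G →* Subgroup.center G :=
  MonoidHom.mk'
    (fun a ↦ MonoidHom.mk' (fun b ↦ ⟨⁅a, b⁆, hc.commutatorElement_mem_center a b⟩) (by
      intro b c
      ext
      have h := Subgroup.mem_center_iff.1 (hc.commutatorElement_mem_center a c) b
      simp only [Subgroup.coe_mul]
      rw [commutatorElement_mul_right_eq_mul_conj, mul_assoc, mul_assoc, ← mul_assoc b, h]
      group))
    (by
      intro a b
      ext c
      have h := Subgroup.mem_center_iff.1 (hc.commutatorElement_mem_center b c) a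
      have h' := Subgroup.mem_center_iff.1 (hc.commutatorElement_mem_center b c) ⁅a, c⁆
      simp only [MonoidHom.mk'_apply, MonoidHom.mul_apply, Subgroup.coe_mul]
      rw [commutatorElement_mul_left_eq_conj_mul, h, h']
      group)

@[simp]
theorem coe_commutatorPairing (hc : IsNilpotentOfClassLE 2 G) (a b : G) :
    (commutatorPairing hc a b : G) = ⁅a, b⁆ := rfl

theorem commutatorPairing_central_left (hc : IsNilpotentOfClassLE 2 G)
    (z : Subgroup.center G) (a : G) : commutatorPairing hc z a = 1 := by
  ext
  rw [coe_commutatorPairing, OneMemClass.coe_one, commutatorElement_eq_one_iff_mul_comm]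
  exact (Subgroup.mem_center_iff.1 z.2 a).symm

theorem commutatorPairing_central_right (hc : IsNilpotentOfClassLE 2 G)
    (a : G) (z : Subgroup.center G) : commutatorPairing hc a z = 1 := by
  ext
  rw [coe_commutatorPairing, OneMemClass.coe_one, commutatorElement_eq_one_iff_mul_comm]
  exact Subgroup.mem_center_iff.1 z.2 a

theorem commutatorPairing_self (hc : IsNilpotentOfClassLE 2 G) (a : G) :
    commutatorPairing hc a a = 1 := by
  ext
  simp

theorem commutatorPairing_inv_swap (hc : IsNilpotentOfClassLE 2 G) (a b : G) :
    commutatorPairing hc b a = (commutatorPairing hc a b)⁻¹ := by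
  ext
  simp

/-- Baer's sum on a group of class at most two in which commutators have square roots. -/
def baerAdd (hc : IsNilpotentOfClassLE 2 G) (n : ℕ) (x y : G) : G :=
  x * y * ((commutatorPairing hc y x ^ n : Subgroup.center G) : G)

/-- The additive group structure of Baer's sum. -/
abbrev baerAddCommGroup (hc : IsNilpotentOfClassLE 2 G) (n : ℕ)
    (hn : ∀ x y : G, commutatorPairing hc x y ^ (2 * n) = commutatorPairing hc x y) :
    AddCommGroup G :=
  letI : Zero G := ⟨1⟩
  letI : Add G := ⟨baerAdd hc n⟩
  letI : Neg G := ⟨Inv.inv⟩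
  { add_assoc x y z := by
      change baerAdd hc n (baerAdd hc n x y) z = baerAdd hc n x (baerAdd hc n y z)
      have h := Subgroup.mem_center_iff.1 (commutatorPairing hc y x ^ n).2 z
      have h' := Subgroup.mem_center_iff.1 (commutatorPairing hc y x ^ n).2
        (commutatorPairing hc z y ^ n : Subgroup.center G)
      simp only [baerAdd, map_mul, commutatorPairing_central_left, commutatorPairing_central_right,
        mul_one, MonoidHom.mul_apply, mul_pow]
      rw [mul_assoc _ _ z, ← h, mul_comm (commutatorPairing hc z x ^ n), Subgroup.coe_mul,
        Subgroup.coe_mul]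
      simp only [mul_assoc]
      rw [← mul_assoc ((commutatorPairing hc y x ^ n : Subgroup.center G) : G), ← h',
        mul_assoc]
    zero_add x := by
      change baerAdd hc n 1 x = x
      simp [baerAdd]
    add_zero x := by
      change baerAdd hc n x 1 = x
      simp [baerAdd]
    neg_add_cancel x := by
      change baerAdd hc n x⁻¹ x = 1
      simp [baerAdd, commutatorPairing_self]
    add_comm x y := by
      change baerAdd hc n x y = baerAdd hc n y x
      have h : x * y = y * x * (commutatorPairing hc x y : G) := by
        rw [Subgroup.mem_center_iff.1 (commutatorPairing hc x y).2, coe_commutatorPairing,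
          commutatorElement_def]
        group
      rw [baerAdd, baerAdd, h, mul_assoc, ← Subgroup.coe_mul]
      congr 2
      rw [commutatorPairing_inv_swap hc x y, inv_pow, mul_inv_eq_iff_eq_mul, ← pow_add, ← two_mul,
        hn]
    nsmul := nsmulRec
    zsmul := zsmulRec }

/-- Powers of `x` commute with `x`, so the correction term disappears. Exponent `p` thus makes
Baer's group a vector space over `ZMod p`. -/
theorem baerAddCommGroup_nsmul (hc : IsNilpotentOfClassLE 2 G) (n : ℕ)
    (hn : ∀ x y : G, commutatorPairing hc x y ^ (2 * n) = commutatorPairing hc x y) (k : ℕ)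
    (x : G) :
    letI := baerAddCommGroup hc n hn
    k • x = x ^ k := by
  let := baerAddCommGroup hc n hn
  induction k with
  | zero => rw [pow_zero]; exact zero_nsmul x
  | succ k ih =>
    rw [succ_nsmul, ih]
    change baerAdd hc n (x ^ k) x = _
    simp [baerAdd, commutatorPairing_self, pow_succ]

variable {p : ℕ} [Fact p.Prime]

theorem exists_addMonoidHom_ne_zero {V : Type*} [AddCommGroup V] (hV : ∀ v : V, p • v = 0)
    {v : V} (hv : v ≠ 0) : ∃ q : V →+ ZMod p, q v ≠ 0 := by
  obtain ⟨_⟩ : Nonempty (Module (ZMod p) V) := ⟨AddCommGroup.zmodModule hV⟩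
  obtain ⟨f, hf⟩ := Module.Projective.exists_dual_ne_zero (ZMod p) hv
  exact ⟨f.toAddMonoidHom, hf⟩

/-- A group of class at most two and odd prime exponent has a quadratic function that does not
vanish at a given nontrivial element. -/
theorem exists_quadratic_ne_zero (hodd : Odd p) (hc : IsNilpotentOfClassLE 2 G)
    (he : ∀ x : G, x ^ p = 1) {g : G} (hg : g ≠ 1) :
    ∃ q : G → ZMod p, q g ≠ 0 ∧ q 1 = 0 ∧ q ∈ polynomialLT G (ZMod p) 3 := by
  obtain ⟨m, hm⟩ := hodd
  -- With `p = 2m + 1`, the number `m + 1` is the inverse of 2 modulo `p`, so raising to this power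
  -- takes the square root of a commutator.
  have hn : ∀ x y : G, commutatorPairing hc x y ^ (2 * (m + 1)) = commutatorPairing hc x y := by
    intro x y
    rw [show 2 * (m + 1) = p + 1 by omega, pow_succ, ← map_pow, he, map_one, one_mul]
  let := baerAddCommGroup hc (m + 1) hn
  obtain ⟨q, hq⟩ := exists_addMonoidHom_ne_zero (p := p) (V := G)
    (fun x ↦ by rw [baerAddCommGroup_nsmul, he]; rfl) (v := g) hg
  have hadd : ∀ x y : G, q (baerAdd hc (m + 1) x y) = q x + q y := map_add q
  have hcentral : ∀ (x : G) (z : Subgroup.center G), q (x * z) = q x + q z := by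
    intro x z
    rw [← hadd, baerAdd, commutatorPairing_central_left, one_pow, OneMemClass.coe_one, mul_one]
  refine ⟨q, hq, map_zero q, mem_polynomialLT_three
    (b := fun x y ↦ q (commutatorPairing hc x y ^ (m + 1) : Subgroup.center G)) ?_ ?_⟩
  · intro x y
    have h : x * y = baerAdd hc (m + 1) x y *
        (commutatorPairing hc x y ^ (m + 1) : Subgroup.center G) := by
      rw [baerAdd, mul_assoc, ← Subgroup.coe_mul, commutatorPairing_inv_swap hc x y, inv_pow,
        inv_mul_cancel, OneMemClass.coe_one, mul_one]
    rw [h, hcentral, hadd]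
  · intro x y z
    rw [map_mul, MonoidHom.mul_apply, mul_pow, Subgroup.coe_mul, hcentral]

end ClassTwo

/-! ### Tensor products: separation by functionals and factorization of pairings. -/

section Tensor

variable {k V W : Type*} [Field k] [AddCommGroup V] [AddCommGroup W] [Module k V] [Module k W]

/-- Products of linear functionals separate the elements of a tensor product. -/
theorem tensorProduct_eq_zero_of_dualDistrib_eq_zero (t : V ⊗[k] W)
    (h : ∀ (f : Module.Dual k V) (g : Module.Dual k W),
      TensorProduct.dualDistrib k V W (f ⊗ₜ g) t = 0) : t = 0 := by
  let b := Module.Basis.ofVectorSpace k V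
  let c := Module.Basis.ofVectorSpace k W
  refine (b.tensorProduct c).ext_elem fun ⟨i, j⟩ ↦ ?_
  have e : (b.tensorProduct c).coord (i, j) =
      TensorProduct.dualDistrib k V W (b.coord i ⊗ₜ c.coord j) := by
    refine TensorProduct.ext' fun x y ↦ ?_
    simp [mul_comm]
  rw [← Module.Basis.coord_apply, e, h, map_zero, Finsupp.zero_apply]

end Tensor

section Pairing

variable {p : ℕ} {A B Z : Type*} [Group A] [Group B] [CommGroup Z]

/-- A bimultiplicative map of groups factors through the tensor product of abelianizations. -/
theorem exists_tensorProduct_factorization [NeZero p] [Module (ZMod p) (Additive (Abelianization A))]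
    [Module (ZMod p) (Additive (Abelianization B))] (β : A →* B →* Z) :
    ∃ τ : Additive (Abelianization A) ⊗[ZMod p] Additive (Abelianization B) →+ Additive Z,
      ∀ a b, τ (.ofMul (.of a) ⊗ₜ .ofMul (.of b)) = .ofMul (β a b) := by
  let β₁ : A →* Abelianization B →* Z := MonoidHom.mk' (fun a ↦ Abelianization.lift (β a)) (by
    intro a a'
    ext b
    simp)
  let F : Additive (Abelianization A) →+ Additive (Abelianization B) →+ Additive Z :=
    AddMonoidHom.mk' (fun x ↦ (Abelianization.lift β₁ x.toMul).toAdditive) (by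
      intro x y
      ext z
      simp)
  refine ⟨TensorProduct.liftAddHom F ?_, fun a b ↦ ?_⟩
  · intro r x y
    -- Scalars in `ZMod p` act as natural multiples, so biadditivity already gives balancedness.
    rw [← ZMod.natCast_zmod_val r, Nat.cast_smul_eq_nsmul, Nat.cast_smul_eq_nsmul, map_nsmul,
      map_nsmul]
    rfl
  · simp [F, β₁]

end Pairing

/-- A group with trivial abelianization is perfect, so its lower central series never descends. -/
theorem IsNilpotentOfClassLE.exists_abelianization_of_ne_one {G : Type u} [Group G] [Nontrivial G]
    (hc : IsNilpotentOfClassLE 2 G) : ∃ g : G, Abelianization.of g ≠ 1 := by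
  by_contra! h
  have h1 : commutator G = ⊤ := by
    rw [← Abelianization.ker_of, MonoidHom.ker_eq_top_iff]
    ext g
    exact h g
  have h2 : (⊤ : Subgroup G).lowerCentralSeries 2 = ⊤ := by
    rw [Subgroup.lowerCentralSeries_succ, Subgroup.top_lowerCentralSeries_one, h1]
    exact h1
  rw [show (⊤ : Subgroup G).lowerCentralSeries 2 = ⊥ from hc] at h2
  exact bot_ne_top h2

theorem isNilpotentOfClassLE_quotient (G : Type u) [Group G] (k : ℕ) :
    IsNilpotentOfClassLE k (G ⧸ (⊤ : Subgroup G).lowerCentralSeries k) := by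
  have h := Subgroup.map_lowerCentralSeries (S := (⊤ : Subgroup G))
    (QuotientGroup.mk' ((⊤ : Subgroup G).lowerCentralSeries k)) k
  rw [QuotientGroup.map_mk'_self, Subgroup.map_top_of_surjective _
    (QuotientGroup.mk'_surjective _)] at h
  exact h.symm

/-! ### Constraints on elements central modulo `F_4`, and mixed commutators. -/

section Center

variable {p : ℕ} [Fact p.Prime] {G : Type u} {K : Type v} [Group G] [Group K]

/-- The displacement of `(0, 1)` is a crossed homomorphism: the scalar coordinate is fixed, and on
pairs with scalar 0 the action factors through the projection to `G`. -/
theorem coprodAction_apply_mul_zero_one {R : Type*} [CommRing R] (q : G → R)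
    (θ : Additive K →+ R) (x y : Monoid.Coprod G K) :
    (coprodAction q θ (x * y) (0, 1)).1 =
      rightTranslation G R (Monoid.Coprod.fst x) (coprodAction q θ y (0, 1)).1 +
        (coprodAction q θ x (0, 1)).1 := by
  have e : coprodAction q θ y (0, 1) = ((coprodAction q θ y (0, 1)).1, 0) + (0, 1) :=
    Prod.ext (by simp) (by simp [coprodAction_snd])
  rw [map_mul, endMul_apply, e, map_add, coprodAction_zero_right]
  simp

/-- An element that is central modulo the fourth term of the lower central series commutes with
the group on the vector `(0, 1)`. -/
theorem coprodAction_comm {R : Type*} [CommRing R] {q : G → R} (hq : q ∈ polynomialLT G R 3)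
    (θ : Additive K →+ R) {x y : Monoid.Coprod G K}
    (hx : (y * x)⁻¹ * (x * y) ∈ (⊤ : Subgroup (Monoid.Coprod G K)).lowerCentralSeries 3) :
    (coprodAction q θ (x * y) (0, 1)).1 = (coprodAction q θ (y * x) (0, 1)).1 := by
  rw [← mul_inv_cancel_left (y * x) (x * y), map_mul, endMul_apply,
    coprodAction_zero_one_of_mem_lowerCentralSeries_three θ hq hx]

/-- Comparing `x * inr b` with `inr b * x` on `(0, 1)` and evaluating at 1 gives `θ(b) q(fst x) =
θ(b) q(1) = 0`, for every quadratic `q` with `q(1) = 0`. -/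
theorem fst_eq_one_of_central (hodd : Odd p) (hc : IsNilpotentOfClassLE 2 G)
    (he : ∀ g : G, g ^ p = 1) {θ : Additive K →+ ZMod p} {b : K} (hb : θ (.ofMul b) ≠ 0)
    {x : Monoid.Coprod G K} (hx : (Monoid.Coprod.inr b * x)⁻¹ * (x * Monoid.Coprod.inr b) ∈
      (⊤ : Subgroup (Monoid.Coprod G K)).lowerCentralSeries 3) :
    Monoid.Coprod.fst x = 1 := by
  by_contra hg
  obtain ⟨q, hq, hq1, hq3⟩ := exists_quadratic_ne_zero hodd hc he hg
  have h := congrFun (coprodAction_comm hq3 θ hx) 1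
  rw [coprodAction_apply_mul_zero_one, coprodAction_apply_mul_zero_one] at h
  simp [hq1, hq, hb] at h

/-- The subgroup of the free product generated by the commutators between the factors. -/
def mixedCommutators (G : Type u) (K : Type v) [Group G] [Group K] :
    Subgroup (Monoid.Coprod G K) :=
  Subgroup.closure
    {x | ∃ (a : G) (b : K), ⁅(Monoid.Coprod.inl a : Monoid.Coprod G K), Monoid.Coprod.inr b⁆ = x}

theorem fst_eq_one_of_mem_mixedCommutators {k : Monoid.Coprod G K}
    (hk : k ∈ mixedCommutators G K) : Monoid.Coprod.fst k = 1 := by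
  have h : mixedCommutators G K ≤ (Monoid.Coprod.fst : Monoid.Coprod G K →* G).ker := by
    rw [mixedCommutators, Subgroup.closure_le]
    rintro _ ⟨a, b, rfl⟩
    simp [MonoidHom.mem_ker, map_commutatorElement]
  exact h hk

theorem snd_eq_one_of_mem_mixedCommutators {k : Monoid.Coprod G K}
    (hk : k ∈ mixedCommutators G K) : Monoid.Coprod.snd k = 1 := by
  have h : mixedCommutators G K ≤ (Monoid.Coprod.snd : Monoid.Coprod G K →* K).ker := by
    rw [mixedCommutators, Subgroup.closure_le]
    rintro _ ⟨a, b, rfl⟩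
    simp [MonoidHom.mem_ker, map_commutatorElement]
  exact h hk

theorem mk_mem_center_of_mem_mixedCommutators {k : Monoid.Coprod G K}
    (hk : k ∈ mixedCommutators G K) :
    (k : NilpotentProduct 2 G K) ∈ Subgroup.center (NilpotentProduct 2 G K) := by
  have h : mixedCommutators G K ≤ (Subgroup.center (NilpotentProduct 2 G K)).comap
      (QuotientGroup.mk' _) := by
    rw [mixedCommutators, Subgroup.closure_le]
    rintro _ ⟨a, b, rfl⟩
    rw [SetLike.mem_coe, Subgroup.mem_comap, map_commutatorElement]
    exact (isNilpotentOfClassLE_quotient _ 2).commutatorElement_mem_center _ _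
  exact h hk

theorem mul_mul_mul_eq_of_mem_center {Q : Type*} [Group Q] {a b c k : Q}
    (hc : c ∈ Subgroup.center Q) (hk : k ∈ Subgroup.center Q) (h : b * a = c * (a * b))
    (x y z : Q) : x * b * k * (a * y * z) = x * a * (b * y) * (c * k * z) := by
  rw [Subgroup.mem_center_iff] at hc hk
  calc x * b * k * (a * y * z) = x * b * (k * (a * y)) * z := by simp only [mul_assoc]
    _ = x * (b * a) * y * k * z := by rw [← hk]; simp only [mul_assoc]
    _ = x * (c * (a * b * y)) * k * z := by rw [h]; simp only [mul_assoc]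
    _ = x * a * (b * y) * (c * k * z) := by rw [← hc]; simp only [mul_assoc]

/-- Normal form of the elements of the free product modulo the third term of the lower central
series. -/
theorem exists_normalForm (x : Monoid.Coprod G K) :
    ∃ (a : G) (b : K), ∃ k ∈ mixedCommutators G K,
      (x : NilpotentProduct 2 G K) =
        ((Monoid.Coprod.inl a * Monoid.Coprod.inr b * k : Monoid.Coprod G K) :
          NilpotentProduct 2 G K) := by
  induction x using Monoid.Coprod.induction_on with
  | inl a => exact ⟨a, 1, 1, one_mem _, by simp⟩
  | inr b => exact ⟨1, b, 1, one_mem _, by simp⟩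
  | mul x y hx hy =>
    obtain ⟨a, b, k, hk, hx⟩ := hx
    obtain ⟨a', b', k', hk', hy⟩ := hy
    let c : Monoid.Coprod G K :=
      ⁅(Monoid.Coprod.inl a' : Monoid.Coprod G K), Monoid.Coprod.inr b⁆⁻¹
    have hc : c ∈ mixedCommutators G K := inv_mem (Subgroup.subset_closure ⟨a', b, rfl⟩)
    refine ⟨a * a', b * b', c * k * k', mul_mem (mul_mem hc hk) hk', ?_⟩
    have h : (Monoid.Coprod.inr b * Monoid.Coprod.inl a' : Monoid.Coprod G K) =
        c * (Monoid.Coprod.inl a' * Monoid.Coprod.inr b) := by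
      simp only [c, commutatorElement_def]; group
    have h' := congrArg (QuotientGroup.mk' ((⊤ : Subgroup (Monoid.Coprod G K)).lowerCentralSeries 2))
      h
    rw [QuotientGroup.mk_mul, hx, hy]
    simp only [map_mul] at h' ⊢
    exact mul_mul_mul_eq_of_mem_center (mk_mem_center_of_mem_mixedCommutators hc)
      (mk_mem_center_of_mem_mixedCommutators hk) h'
      ((Monoid.Coprod.inl a : Monoid.Coprod G K) : NilpotentProduct 2 G K)
      ((Monoid.Coprod.inr b' : Monoid.Coprod G K) : NilpotentProduct 2 G K)
      (k' : NilpotentProduct 2 G K)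

/-- With `q = f ^ 2`, the commutator of `a` and `b` displaces `(0, 1)` by `g(b)` times the
difference of `q` in direction `a`, which is affine of slope `2 f(a) g(b)` in `f(h)`. Displacements
add over products, since mixed commutators project trivially to `G`. One tensor `t` thus controls
both the class of `k` and its action, so `t = 0` will force that class to be trivial. -/
theorem exists_tensor_of_mem_mixedCommutators
    [Module (ZMod p) (Additive (Abelianization G))] [Module (ZMod p) (Additive (Abelianization K))]
    (τ : Additive (Abelianization G) ⊗[ZMod p] Additive (Abelianization K) →+
      Additive (Subgroup.center (NilpotentProduct 2 G K)))
    (hτ : ∀ a b, ((τ (.ofMul (.of a) ⊗ₜ .ofMul (.of b))).toMul : NilpotentProduct 2 G K) =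
      (⁅(Monoid.Coprod.inl a : Monoid.Coprod G K), Monoid.Coprod.inr b⁆ : Monoid.Coprod G K))
    {k : Monoid.Coprod G K} (hk : k ∈ mixedCommutators G K) :
    ∃ t : Additive (Abelianization G) ⊗[ZMod p] Additive (Abelianization K),
      ((τ t).toMul : NilpotentProduct 2 G K) = k ∧
      ∀ (f : Module.Dual (ZMod p) (Additive (Abelianization G)))
        (g : Module.Dual (ZMod p) (Additive (Abelianization K))) (h : G),
        (coprodAction (fun y ↦ f (.ofMul (.of y)) ^ 2)
            (g.toAddMonoidHom.comp (Abelianization.of (G := K)).toAdditive) k (0, 1)).1 h -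
          (coprodAction (fun y ↦ f (.ofMul (.of y)) ^ 2)
            (g.toAddMonoidHom.comp (Abelianization.of (G := K)).toAdditive) k (0, 1)).1 1 =
        2 * f (.ofMul (.of h)) * TensorProduct.dualDistrib _ _ _ (f ⊗ₜ g) t := by
  rw [mixedCommutators] at hk
  induction hk using Subgroup.closure_induction with
  | one => exact ⟨0, by rw [map_zero]; rfl, by simp [endOne_apply]⟩
  | mul x y hx hy ihx ihy =>
    obtain ⟨t, ht, ht'⟩ := ihx
    obtain ⟨s, hs, hs'⟩ := ihy
    refine ⟨t + s, by rw [map_add, toMul_add, Subgroup.coe_mul, ht, hs]; rfl, fun f g h ↦ ?_⟩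
    rw [coprodAction_apply_mul_zero_one, fst_eq_one_of_mem_mixedCommutators hx, map_one,
      endOne_apply, Pi.add_apply, Pi.add_apply, map_add, mul_add, ← ht', ← hs']
    ring
  | inv x hx ihx =>
    obtain ⟨t, ht, ht'⟩ := ihx
    refine ⟨-t, by rw [map_neg, toMul_neg, Subgroup.coe_inv, ht]; rfl, fun f g h ↦ ?_⟩
    have e := coprodAction_apply_mul_zero_one (fun y ↦ f (.ofMul (.of y)) ^ 2)
      (g.toAddMonoidHom.comp (Abelianization.of (G := K)).toAdditive) x x⁻¹
    rw [mul_inv_cancel, map_one, endOne_apply, fst_eq_one_of_mem_mixedCommutators hx, map_one,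
      endOne_apply] at e
    have e' := eq_neg_of_add_eq_zero_left e.symm
    rw [e', map_neg, mul_neg, ← ht', Pi.neg_apply, Pi.neg_apply]
    ring
  | mem x hx =>
    obtain ⟨a, b, rfl⟩ := hx
    refine ⟨_, hτ a b, fun f g h ↦ ?_⟩
    rw [commutatorElement_def, ← map_inv, ← map_inv]
    simp only [coprodAction_apply_mul_zero_one]
    have e : g (.ofMul (.of b⁻¹)) = -g (.ofMul (.of b)) := by rw [map_inv, ofMul_inv, map_neg]
    simp [-map_inv, e]
    ring

end Center

/-! ### Elements central modulo `F_4` lie in `F_3`. -/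

section Epicenter

variable {p : ℕ} [Fact p.Prime] {G : Type u} {K : Type v} [Group G] [Group K]

/-- Commuting with `inl y` says that the displacement of `(0, 1)` by `k * r` takes equal values at
`y` and 1. The factor `r` contributes only a constant, so `2 f(y)` times the value of `f ⊗ g` on `t`
vanishes for all `y`. -/
theorem mk_eq_one_of_mem_mixedCommutators
    [Module (ZMod p) (Additive (Abelianization G))] [Module (ZMod p) (Additive (Abelianization K))]
    (hodd : Odd p) {k r : Monoid.Coprod G K} (hk : k ∈ mixedCommutators G K)
    (hr : r ∈ (⊤ : Subgroup (Monoid.Coprod G K)).lowerCentralSeries 2)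
    (hx : ∀ y, (y * (k * r))⁻¹ * (k * r * y) ∈
      (⊤ : Subgroup (Monoid.Coprod G K)).lowerCentralSeries 3) :
    (k : NilpotentProduct 2 G K) = 1 := by
  obtain ⟨τ, hτ⟩ := exists_tensorProduct_factorization (p := p)
    ((((commutatorPairing (isNilpotentOfClassLE_quotient (Monoid.Coprod G K) 2)).comp
      ((QuotientGroup.mk' _).comp Monoid.Coprod.inl)).flip.comp
      ((QuotientGroup.mk' _).comp Monoid.Coprod.inr)).flip : G →* K →* _)
  obtain ⟨t, ht, h⟩ := exists_tensor_of_mem_mixedCommutators τ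
    (fun a b ↦ by rw [hτ]; rfl) hk
  rw [← ht, tensorProduct_eq_zero_of_dualDistrib_eq_zero t, map_zero, toMul_zero,
    OneMemClass.coe_one]
  intro f g
  have hq : (fun y : G ↦ f (.ofMul (.of y)) ^ 2) ∈ polynomialLT G (ZMod p) 3 :=
    mem_polynomialLT_three
      (b := fun x y ↦ 2 * f (.ofMul (.of x)) * f (.ofMul (.of y)))
      (fun x y ↦ by simp only [map_mul, ofMul_mul, map_add]; ring)
      (fun x y z ↦ by simp only [map_mul, ofMul_mul, map_add]; ring)
  let θ : Additive K →+ ZMod p := g.toAddMonoidHom.comp (Abelianization.of (G := K)).toAdditive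
  obtain ⟨c, hc⟩ := coprodAction_zero_one_of_mem_lowerCentralSeries_two θ hq hr
  have key : ∀ y : G, 2 * f (.ofMul (.of y)) * TensorProduct.dualDistrib _ _ _ (f ⊗ₜ g) t = 0 := by
    intro y
    rw [← h f g y]
    have e := congrFun (coprodAction_comm hq θ (hx (.inl y))) 1
    have hkr : ∀ z, (coprodAction (fun y ↦ f (.ofMul (.of y)) ^ 2) θ (k * r) (0, 1)).1 z =
        c + (coprodAction (fun y ↦ f (.ofMul (.of y)) ^ 2) θ k (0, 1)).1 z := fun z ↦ by
      rw [coprodAction_apply_mul_zero_one, hc, fst_eq_one_of_mem_mixedCommutators hk, map_one]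
      rfl
    rw [coprodAction_apply_mul_zero_one, coprodAction_apply_mul_zero_one _ _ (Monoid.Coprod.inl y),
      coprodAction_inl, map_zero, map_zero, zero_add, add_zero, rightTranslation_apply, hkr, hkr,
      Monoid.Coprod.fst_apply_inl, one_mul] at e
    exact sub_eq_zero.2 (add_left_cancel e).symm
  by_contra hne
  have h2 : (2 : ZMod p) ≠ 0 := by
    intro h2
    have := (ZMod.natCast_eq_zero_iff 2 p).1 (by exact_mod_cast h2)
    have h3 := (Nat.prime_dvd_prime_iff_eq Fact.out Nat.prime_two).1 this
    rw [h3] at hodd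
    exact absurd hodd (by decide)
  have hf : f = 0 := by
    ext v
    induction v using Additive.rec with | ofMul v => ?_
    obtain ⟨y, rfl⟩ := QuotientGroup.mk_surjective v
    exact (mul_eq_zero.1 ((mul_eq_zero.1 (key y)).resolve_right hne)).resolve_left h2
  exact hne (by rw [hf, TensorProduct.zero_tmul, map_zero, LinearMap.zero_apply])

theorem nsmul_additive_abelianization_eq_zero {n : ℕ} (he : ∀ g : G, g ^ n = 1)
    (v : Additive (Abelianization G)) : n • v = 0 := by
  obtain ⟨y, hy⟩ : ∃ y, Abelianization.of y = v.toMul := QuotientGroup.mk_surjective v.toMul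
  refine Additive.toMul.injective ?_
  rw [toMul_nsmul, ← hy, ← map_pow, he, map_one, toMul_zero]

theorem exists_character_ne_zero [Nontrivial G] (hc : IsNilpotentOfClassLE 2 G)
    (he : ∀ g : G, g ^ p = 1) : ∃ (θ : Additive G →+ ZMod p) (g : G), θ (.ofMul g) ≠ 0 := by
  obtain ⟨g, hg⟩ := hc.exists_abelianization_of_ne_one
  obtain ⟨q, hq⟩ := exists_addMonoidHom_ne_zero (p := p) (V := Additive (Abelianization G))
    (nsmul_additive_abelianization_eq_zero he) (v := .ofMul (.of g)) hg
  exact ⟨q.comp (Abelianization.of (G := G)).toAdditive, g, hq⟩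

variable [Nontrivial G] [Nontrivial K]

theorem IsNilpotentOfClassLE.map_eq_one {Γ Q : Type*} [Group Γ] [Group Q] {n : ℕ}
    (hQ : IsNilpotentOfClassLE n Q) (φ : Γ →* Q) {r : Γ}
    (hr : r ∈ (⊤ : Subgroup Γ).lowerCentralSeries n) : φ r = 1 := by
  have h := Subgroup.mem_map_of_mem φ hr
  rw [Subgroup.map_lowerCentralSeries] at h
  have h' : φ r ∈ (⊤ : Subgroup Q).lowerCentralSeries n :=
    Subgroup.lowerCentralSeries_mono n le_top h
  rwa [show (⊤ : Subgroup Q).lowerCentralSeries n = ⊥ from hQ] at h'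

/-- An element of the free product that is central modulo the fourth term of the lower central
series lies in the third term. -/
theorem mem_lowerCentralSeries_two_of_central (hodd : Odd p) (hG : IsNilpotentOfClassLE 2 G)
    (hK : IsNilpotentOfClassLE 2 K) (heG : ∀ g : G, g ^ p = 1) (heK : ∀ g : K, g ^ p = 1)
    {x : Monoid.Coprod G K} (hx : ∀ y, (y * x)⁻¹ * (x * y) ∈
      (⊤ : Subgroup (Monoid.Coprod G K)).lowerCentralSeries 3) :
    x ∈ (⊤ : Subgroup (Monoid.Coprod G K)).lowerCentralSeries 2 := by
  obtain ⟨θ, b, hb⟩ := exists_character_ne_zero hK heK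
  have h1 := fst_eq_one_of_central hodd hG heG hb (hx _)
  obtain ⟨θ', a, ha⟩ := exists_character_ne_zero hG heG
  have h2 : Monoid.Coprod.snd x = 1 := by
    -- Exchanging the factors preserves the lower central series, so the previous argument applies
    -- with the roles of `G` and `K` reversed.
    rw [← Monoid.Coprod.fst_swap]
    refine fst_eq_one_of_central hodd hK heK ha ?_
    have h := Subgroup.mem_map_of_mem (Monoid.Coprod.swap G K) (hx (.inl a))
    rw [Subgroup.map_lowerCentralSeries, Subgroup.map_top_of_surjective _
      Monoid.Coprod.swap_surjective] at h
    simpa using h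
  obtain ⟨c, d, k, hk, hxk⟩ := exists_normalForm x
  have hr := QuotientGroup.eq.1 hxk.symm
  set r := (Monoid.Coprod.inl c * Monoid.Coprod.inr d * k)⁻¹ * x with hr'
  have hxr : x = Monoid.Coprod.inl c * Monoid.Coprod.inr d * k * r := by
    rw [hr', mul_inv_cancel_left]
  rw [hxr] at h1 h2 hx ⊢
  rw [map_mul, map_mul, map_mul, Monoid.Coprod.fst_apply_inl, Monoid.Coprod.fst_apply_inr,
    fst_eq_one_of_mem_mixedCommutators hk, hG.map_eq_one _ hr, mul_one, mul_one, mul_one] at h1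
  rw [map_mul, map_mul, map_mul, Monoid.Coprod.snd_apply_inl, Monoid.Coprod.snd_apply_inr,
    snd_eq_one_of_mem_mixedCommutators hk, hK.map_eq_one _ hr, one_mul, mul_one, mul_one] at h2
  rw [h1, h2, map_one, map_one, one_mul, one_mul] at hx ⊢
  obtain ⟨_⟩ : Nonempty (Module (ZMod p) (Additive (Abelianization G))) :=
    ⟨AddCommGroup.zmodModule (nsmul_additive_abelianization_eq_zero heG)⟩
  obtain ⟨_⟩ : Nonempty (Module (ZMod p) (Additive (Abelianization K))) :=
    ⟨AddCommGroup.zmodModule (nsmul_additive_abelianization_eq_zero heK)⟩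
  exact mul_mem ((QuotientGroup.eq_one_iff k).1 (mk_eq_one_of_mem_mixedCommutators hodd hk hr hx))
    hr

end Epicenter

/-! ### The center of `F/F_4`, and capability. -/

theorem mainTheorem10 {p : ℕ} (hp : p.Prime) (hodd : Odd p)
    (G₁ : Type u) (G₂ : Type v) [Group G₁] [Group G₂] [Nontrivial G₁] [Nontrivial G₂]
    (hc₁ : IsNilpotentOfClassLE 2 G₁) (hc₂ : IsNilpotentOfClassLE 2 G₂)
    (he₁ : Monoid.exponent G₁ = p) (he₂ : Monoid.exponent G₂ = p) :
    IsCapable (NilpotentProduct 2 G₁ G₂) := by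
  have : Fact p.Prime := ⟨hp⟩
  let N := (⊤ : Subgroup (Monoid.Coprod G₁ G₂)).lowerCentralSeries 3
  let M := (⊤ : Subgroup (Monoid.Coprod G₁ G₂)).lowerCentralSeries 2
  have hNM : N ≤ M := Subgroup.lowerCentralSeries_antitone _ (by norm_num)
  have hcenter : Subgroup.center (Monoid.Coprod G₁ G₂ ⧸ N) = M.map (QuotientGroup.mk' N) := by
    ext z
    obtain ⟨x, rfl⟩ := QuotientGroup.mk_surjective z
    constructor
    · intro hx
      refine Subgroup.mem_map_of_mem _ (mem_lowerCentralSeries_two_of_central hodd hc₁ hc₂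
        (fun g ↦ he₁ ▸ Monoid.pow_exponent_eq_one g) (fun g ↦ he₂ ▸ Monoid.pow_exponent_eq_one g)
        fun y ↦ ?_)
      exact QuotientGroup.eq.1 (Subgroup.mem_center_iff.1 hx y)
    · rintro ⟨y, hy, hyx⟩
      rw [← hyx, Subgroup.mem_center_iff]
      intro w
      obtain ⟨w, rfl⟩ := QuotientGroup.mk_surjective w
      have h : ⁅y, w⁆ ∈ N := Subgroup.commutator_mem_commutator hy (Subgroup.mem_top w)
      rw [← QuotientGroup.eq_one_iff, ← QuotientGroup.mk'_apply, map_commutatorElement,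
        commutatorElement_eq_one_iff_mul_comm] at h
      exact h.symm
  exact ⟨Monoid.Coprod G₁ G₂ ⧸ N, inferInstance,
    ⟨((QuotientGroup.quotientMulEquivOfEq hcenter).trans
      (QuotientGroup.quotientQuotientEquivQuotient N M hNM)).symm⟩⟩
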